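/- A (non-degenerate) hyper-ideal tetrahedron is a compact convex polyhedron in hyperbolic space $\mathbb{H}^3$ with the combinatorics of a truncated tetrahedron: it has four hexagonal faces and four triangular faces $\Delta_1,\dots,\Delta_4$ (the vertex triangles), and each triangular face is orthogonal to its three adjacent hexagonal faces (so the hexagons are right-angled). The edge $\{ij\}$ is the edge shared by two hexagonal faces that joins $\Delta_i$ to $\Delta_j$; its length is denoted $l_{ij}$. For distinct $i,j,k$, the vertex edge length $x^i_{jk}$ is the length of the side in which $\Delta_i$ meets the hexagonal face $\{ijk\}$. Numbers $l_{ij}$ $(1\le i<j\le 4)$ are said to determine a non-degenerate hyper-ideal tetrahedron if there is a hyper-ideal tetrahedron with these edge lengths and it is unique up to isometries of $\mathbb{H}^3$ respecting the labels. The admissible space of a tetrahedron is the set of all $r=(r_1,r_2,r_3,r_4)\in\mathbb{R}_{>0}^4$ for which the numbers $l_{ij}=r_i+r_j$ determine a non-degenerate hyper-ideal tetrahedron. Let $\Sigma$ be a compact 3-manifold with boundary, and let $\tilde\Sigma$ be obtained from $\Sigma$ by coning off each boundary component to a point. An ideal triangulation $\mathcal{T}$ of $\Sigma$ is a finite triangulation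 of $\tilde\Sigma$ (obtained by affinely gluing faces of tetrahedra; several vertices of one tetrahedron may coincide) whose vertices are exactly the cone points. Let $N$ be the number of components of $\partial\Sigma$. The admissible space $\Omega$ of $(\Sigma,\mathcal{T})$ is the intersection, over all tetrahedra $\sigma$ of $\mathcal{T}$, of the sets of those $r\in\mathbb{R}^N$ whose values at the four vertices of $\sigma$ form a point of the admissible space of $\sigma$. For $t=(t_1,\dots,t_4)\in\mathbb{R}^4$ put $Q_2(t)=\left(\sum_a t_a\right)^2-2\sum_a t_a^2+4$. **Theorem.** 1. The admissible space of a hyper-ideal tetrahedron is $\mathbb{R}_{>0}^4$. 2. For every ideally triangulated compact 3-manifold with boundary $(\Sigma,\mathcal{T})$, the admissible space $\Omega$ is $\mathbb{R}_{>0}^N$. 3. Let $r\in\mathbb{R}_{>0}^4$. The numbers $l_{ij}=r_i+r_j$ determine a non-degenerate hyper-ideal tetrahedron if and only if $Q_2(\tanh r_1,\dots,\tanh r_4)>0$. Moreover, in every hyper-ideal tetrahedron with these edge lengths, for any $i,j,k,h$ with $\{i,j,k,h\}=\{1,2,3,4\}$, the lengths $x=x^i_{jk}$, $y=x^i_{jh}$,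 $z=x^i_{kh}$ of the sides of $\Delta_i$ satisfy $$4\sinh\tfrac{x+y+z}{2}\,\sinh\tfrac{x+y-z}{2}\,\sinh\tfrac{x-y+z}{2}\,\sinh\tfrac{-x+y+z}{2}=\frac{4\cosh^2 r_i\cosh^2 r_j\cosh^2 r_k\cosh^2 r_h}{\sinh^2(r_i+r_j)\,\sinh^2(r_i+r_k)\,\sinh^2(r_i+r_h)}\;Q_2(\tanh r_1,\dots,\tanh r_4).$$ 4. $Q_2(t)>0$ for all $t\in(0,1)^4$. -/

import Mathlib

open scoped Manifold

namespace HyperIdeal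

/-! ### Hyperbolic 3-space: the hyperboloid model -/

/-- The Lorentzian inner product of signature (3,1) on `ℝ⁴`. -/
def mink (x y : Fin 4 → ℝ) : ℝ :=
  -(x 0 * y 0) + x 1 * y 1 + x 2 * y 2 + x 3 * y 3

/-- Hyperbolic 3-space, as the upper sheet of the hyperboloid. -/
def HypSpace : Type :=
  {x : Fin 4 → ℝ // mink x x = -1 ∧ 0 < x 0}

/-- The hyperbolic distance. -/
noncomputable def hdist (x y : HypSpace) : ℝ :=
  Real.arcosh (-(mink x.1 y.1))

/-- The (geodesic) convex hull of a subset of hyperbolic 3-space. In the Klein model it is the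
ordinary convex hull; in the hyperboloid model it is the radial projection of the ordinary
convex hull to the hyperboloid. -/
def hypConvexHull (S : Set HypSpace) : Set HypSpace :=
  {x | ∃ c : ℝ, 0 < c ∧ c • x.1 ∈ convexHull ℝ (Subtype.val '' S)}

/-! ### Hyper-ideal tetrahedra -/

/-- A (non-degenerate) hyper-ideal tetrahedron with hyper-ideal vertices labelled by `Fin 4`:
a compact convex polyhedron in hyperbolic 3-space with the combinatorics of a truncated
tetrahedron, whose triangular faces are orthogonal to the adjacent hexagonal faces.

The polyhedron is the convex hull of twelve points `corner i j` (`i ≠ j`), where `corner i j` is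
the end at the vertex triangle `Δ_i` of the edge `{ij}`; the diagonal values `corner i i` are not
used. It has eight supporting planes, given by their space-like normals: the plane normal to
`truncNormal i` supports it exactly along the vertex triangle `Δ_i`, with corners `corner i j`,
and the plane normal to `faceNormal h` supports it exactly along the hexagonal face opposite to
the vertex `h`, with the six corners `corner i j`, `i, j ≠ h`. As the hexagonal faces adjacent to
`Δ_i` are those opposite to `h ≠ i`, the last field says that triangular faces are orthogonal to
the adjacent hexagonal faces; equivalently, the hexagonal faces are right-angled there. -/
structure HyperIdealTetrahedron where
  corner : Fin 4 → Fin 4 → HypSpace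
  truncNormal : Fin 4 → Fin 4 → ℝ
  faceNormal : Fin 4 → Fin 4 → ℝ
  truncNormal_spacelike : ∀ i, 0 < mink (truncNormal i) (truncNormal i)
  faceNormal_spacelike : ∀ h, 0 < mink (faceNormal h) (faceNormal h)
  trunc_corner_eq : ∀ i j, i ≠ j → mink (truncNormal i) (corner i j).1 = 0
  trunc_corner_neg : ∀ i j k, j ≠ k → j ≠ i → mink (truncNormal i) (corner j k).1 < 0
  face_corner_eq : ∀ h i j, i ≠ j → h ≠ i → h ≠ j → mink (faceNormal h) (corner i j).1 = 0
  face_corner_neg : ∀ h i j, i ≠ j → h = i ∨ h = j → mink (faceNormal h) (corner i j).1 < 0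
  orthogonal : ∀ i h, i ≠ h → mink (truncNormal i) (faceNormal h) = 0

namespace HyperIdealTetrahedron

/-- The underlying polyhedron. -/
def carrier (P : HyperIdealTetrahedron) : Set HypSpace :=
  hypConvexHull {x | ∃ i j, i ≠ j ∧ x = P.corner i j}

/-- The length of the edge `{ij}`, which joins the vertex triangles `Δ_i` and `Δ_j`. -/
noncomputable def edgeLength (P : HyperIdealTetrahedron) (i j : Fin 4) : ℝ :=
  hdist (P.corner i j) (P.corner j i)

/-- The length `x^i_{jk}` of the vertex edge in which the vertex triangle `Δ_i` meets the
hexagonal face `{ijk}`. -/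
noncomputable def vertexEdgeLength (P : HyperIdealTetrahedron) (i j k : Fin 4) : ℝ :=
  hdist (P.corner i j) (P.corner i k)

/-- The edge lengths of `P` are the numbers `l i j`. -/
def HasEdgeLengths (P : HyperIdealTetrahedron) (l : Fin 4 → Fin 4 → ℝ) : Prop :=
  ∀ i j, i ≠ j → P.edgeLength i j = l i j

/-- Some isometry of hyperbolic 3-space takes `P` to `P'` and respects the labelling. -/
def Congruent (P P' : HyperIdealTetrahedron) : Prop :=
  ∃ φ : HypSpace ≃ HypSpace, (∀ x y, hdist (φ x) (φ y) = hdist x y) ∧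
    φ '' P.carrier = P'.carrier ∧ ∀ i j, i ≠ j → φ (P.corner i j) = P'.corner i j

end HyperIdealTetrahedron

/-- The numbers `l i j` determine a non-degenerate hyper-ideal tetrahedron: there is one with
these edge lengths, and it is unique up to isometry. -/
def DeterminesTetrahedron (l : Fin 4 → Fin 4 → ℝ) : Prop :=
  ∃ P : HyperIdealTetrahedron, P.HasEdgeLengths l ∧
    ∀ P' : HyperIdealTetrahedron, P'.HasEdgeLengths l → P.Congruent P'

/-- The admissible space of generalized sphere packing metrics on one hyper-ideal tetrahedron. -/
def admissibleSpace : Set (Fin 4 → ℝ) :=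
  {r | (∀ i, 0 < r i) ∧ DeterminesTetrahedron (fun i j => r i + r j)}

/-- The polynomial `Q₂`. -/
def Q₂ (t : Fin 4 → ℝ) : ℝ :=
  (∑ i, t i) ^ 2 - 2 * ∑ i, t i ^ 2 + 4

/-! ### Ideal triangulations of compact 3-manifolds with boundary -/

section Triangulation

variable (M : Type*) [TopologicalSpace M] [ChartedSpace (EuclideanHalfSpace 3) M]

/-- The connected components of the boundary of `M`. -/
abbrev BoundaryComponent : Type _ :=
  ConnectedComponents ((𝓡∂ 3).boundary M)

/-- Two points are identified if they are equal or lie in the same boundary component. -/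
def coneSetoid : Setoid M where
  r x y := x = y ∨ ∃ (hx : x ∈ (𝓡∂ 3).boundary M) (hy : y ∈ (𝓡∂ 3).boundary M),
    (ConnectedComponents.mk (⟨x, hx⟩ : (𝓡∂ 3).boundary M) : BoundaryComponent M) =
      ConnectedComponents.mk (⟨y, hy⟩ : (𝓡∂ 3).boundary M)
  iseqv :=
    { refl := fun _ => Or.inl rfl
      symm := by
        rintro x y (h | ⟨hx, hy, h⟩)
        · exact Or.inl h.symm
        · exact Or.inr ⟨hy, hx, h.symm⟩
      trans := by
        rintro x y z (rfl | ⟨hx, hy, h⟩) (rfl | ⟨hy', hz, h'⟩)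
        · exact Or.inl rfl
        · exact Or.inr ⟨hy', hz, h'⟩
        · exact Or.inr ⟨hx, hy, h⟩
        · exact Or.inr ⟨hx, hz, h.trans h'⟩ }

/-- The space obtained from `M` by turning each boundary component into a single (cone) point.
Since the boundary of a compact manifold is collared, collapsing the boundary components to
points and attaching cones to them give homeomorphic spaces. -/
abbrev ConedSpace : Type _ :=
  Quotient (coneSetoid M)

/-- The cone point of a boundary component. -/
def conePoint (v : BoundaryComponent M) : ConedSpace M :=
  Quotient.lift (s := connectedComponentSetoid ((𝓡∂ 3).boundary M))
    (fun x : (𝓡∂ 3).boundary M => (Quotient.mk (coneSetoid M) x.1 : ConedSpace M))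
    (fun x y h => Quotient.sound (Or.inr ⟨x.2, y.2, Quotient.sound h⟩)) v

/-- An ideal triangulation of `M`: a triangulation of the coned space whose vertices are exactly
the cone points. It is given by the characteristic maps of its finitely many tetrahedra. The map
of a tetrahedron is injective on each open face of the simplex, distinct tetrahedra have disjoint
interiors, and whenever the images of two points meet, the (closed) faces spanned by these points
are identified by an affine homeomorphism, induced by a bijection of their vertices. Different
faces of one tetrahedron may be identified with each other, and several tetrahedra may have the
same vertices. -/
structure IdealTriangulation where
  Tet : Type
  finite_tet : Finite Tet
  charMap : Tet → stdSimplex ℝ (Fin 4) → ConedSpace M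
  continuous_charMap : ∀ σ, Continuous (charMap σ)
  surjective : ∀ x : ConedSpace M, ∃ σ p, charMap σ p = x
  injective_openFace : ∀ σ (p q : stdSimplex ℝ (Fin 4)), (∀ a, p a = 0 ↔ q a = 0) →
    charMap σ p = charMap σ q → p = q
  disjoint_interior : ∀ σ τ (p q : stdSimplex ℝ (Fin 4)), (∀ a, p a ≠ 0) →
    charMap σ p = charMap τ q → σ = τ
  face_gluing : ∀ σ τ (p q : stdSimplex ℝ (Fin 4)), charMap σ p = charMap τ q →
    ∃ e : Equiv.Perm (Fin 4), q = stdSimplex.map e p ∧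
      ∀ p' : stdSimplex ℝ (Fin 4), (∀ a, p a = 0 → p' a = 0) →
        charMap σ p' = charMap τ (stdSimplex.map e p')
  /-- The `a`-th vertex of the tetrahedron `σ`, as a boundary component of `M`. -/
  vertex : Tet → Fin 4 → BoundaryComponent M
  charMap_vertex : ∀ σ a, charMap σ (stdSimplex.vertex a) = conePoint M (vertex σ a)
  vertex_surjective : ∀ v : BoundaryComponent M, ∃ σ a, vertex σ a = v

variable {M}

/-- The admissible space of generalized sphere packing metrics on a triangulated manifold: the
intersection over all tetrahedra `σ` of the sets of those `r`, defined on the set of boundary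
components, whose restriction to the vertices of `σ` lies in the admissible space of `σ`. -/
def IdealTriangulation.admissibleSpace (T : IdealTriangulation M) :
    Set (BoundaryComponent M → ℝ) :=
  ⋂ σ : T.Tet, {r | (fun a => r (T.vertex σ a)) ∈ HyperIdeal.admissibleSpace}

end Triangulation

end HyperIdeal

/-! In the hyperboloid model a hyper-ideal tetrahedron is encoded by the outward unit normals n_i of
the planes of its vertex triangles. They satisfy ⟨n_i, n_j⟩ = -cosh l_ij, and the corner of {ij} at
Δ_i is (n_j + cosh l_ij n_i) / sinh l_ij (`one_lt_and_unitNormal_eq`, `corner_eq`). The n_i form a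
basis, so equal edge lengths give a linear Lorentz isometry matching normals and corners
(`congruent_of_edgeLength_eq`).

If l_ij = r_i + r_j and t_i = tanh r_i, the addition formula factors the Gram matrix as D (2I - 11ᵀ
- ttᵀ) D with D = diag(cosh r_i); its determinant is -4 (∏ cosh r_i)² Q₂(t). For Q₂(t) > 0 the
signature is (3,1), so vectors with this Gram matrix exist in Minkowski space, and a rescaled dual
basis supplies the face normals (`exists_gram_and_dual`). Since Q₂(t) = 4 - ∑ t_i² + 2 ∑_{i<j} t_i
t_j is positive on (0,1)⁴, every positive r is admissible. The sinh identity computes the same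
determinant through the Schur complement of the diagonal entry at i. -/

namespace HyperIdeal

/-! ### Minkowski space -/

/-- The Lorentzian inner product as a bilinear form. -/
noncomputable def minkForm : LinearMap.BilinForm ℝ (Fin 4 → ℝ) :=
  LinearMap.mk₂ ℝ mink
    (fun x y z => by simp only [mink, Pi.add_apply]; ring)
    (fun c x y => by simp only [mink, Pi.smul_apply, smul_eq_mul]; ring)
    (fun x y z => by simp only [mink, Pi.add_apply]; ring)
    (fun c x y => by simp only [mink, Pi.smul_apply, smul_eq_mul]; ring)

@[simp] lemma minkForm_apply (x y : Fin 4 → ℝ) : minkForm x y = mink x y := rfl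

lemma mink_comm (x y : Fin 4 → ℝ) : mink x y = mink y x := by
  simp only [mink]; ring

@[simp] lemma mink_add_left (x y z : Fin 4 → ℝ) : mink (x + y) z = mink x z + mink y z := by
  simp only [mink, Pi.add_apply]; ring

@[simp] lemma mink_add_right (x y z : Fin 4 → ℝ) : mink x (y + z) = mink x y + mink x z := by
  simp only [mink, Pi.add_apply]; ring

@[simp] lemma mink_sub_left (x y z : Fin 4 → ℝ) : mink (x - y) z = mink x z - mink y z := by
  simp only [mink, Pi.sub_apply]; ring

@[simp] lemma mink_sub_right (x y z : Fin 4 → ℝ) : mink x (y - z) = mink x y - mink x z := by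
  simp only [mink, Pi.sub_apply]; ring

@[simp] lemma mink_smul_left (c : ℝ) (x y : Fin 4 → ℝ) : mink (c • x) y = c * mink x y := by
  simp only [mink, Pi.smul_apply, smul_eq_mul]; ring

@[simp] lemma mink_smul_right (c : ℝ) (x y : Fin 4 → ℝ) : mink x (c • y) = c * mink x y := by
  simp only [mink, Pi.smul_apply, smul_eq_mul]; ring

@[simp] lemma mink_zero_left (y : Fin 4 → ℝ) : mink 0 y = 0 := by simp [mink]

lemma mink_sum_left {ι : Type*} (s : Finset ι) (f : ι → Fin 4 → ℝ) (y : Fin 4 → ℝ) :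
    mink (∑ i ∈ s, f i) y = ∑ i ∈ s, mink (f i) y := by
  simp only [← minkForm_apply, map_sum, LinearMap.sum_apply]

lemma mink_sum_right {ι : Type*} (s : Finset ι) (f : ι → Fin 4 → ℝ) (y : Fin 4 → ℝ) :
    mink y (∑ i ∈ s, f i) = ∑ i ∈ s, mink y (f i) := by
  simp only [← minkForm_apply, map_sum]

lemma eq_zero_of_mink_eq_zero {x : Fin 4 → ℝ} (h : ∀ y, mink x y = 0) : x = 0 := by
  have h0 := h (Pi.single 0 1)
  have h1 := h (Pi.single 1 1)
  have h2 := h (Pi.single 2 1)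
  have h3 := h (Pi.single 3 1)
  simp [mink] at h0 h1 h2 h3
  funext i
  fin_cases i <;> simp [h0, h1, h2, h3]

/-- Four linearly independent vectors of Minkowski space, as a basis. -/
noncomputable def basisOfIndep {e : Fin 4 → Fin 4 → ℝ} (he : LinearIndependent ℝ e) :
    Module.Basis (Fin 4) ℝ (Fin 4 → ℝ) :=
  basisOfLinearIndependentOfCardEqFinrank he (by simp)

@[simp] lemma basisOfIndep_apply {e : Fin 4 → Fin 4 → ℝ} (he : LinearIndependent ℝ e)
    (i : Fin 4) : basisOfIndep he i = e i := by
  simp [basisOfIndep]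

lemma eq_zero_of_mink_indep {e : Fin 4 → Fin 4 → ℝ} (he : LinearIndependent ℝ e)
    {x : Fin 4 → ℝ} (h : ∀ i, mink x (e i) = 0) : x = 0 := by
  have : minkForm x = 0 := (basisOfIndep he).ext fun i => by simpa using h i
  exact eq_zero_of_mink_eq_zero fun y => by rw [← minkForm_apply, this]; rfl

lemma spatial_cauchy_schwarz {x y : Fin 4 → ℝ} (hx : mink x x = -1) (hy : mink y y = -1) :
    (mink x y + x 0 * y 0) ^ 2 ≤ (x 0 ^ 2 - 1) * (y 0 ^ 2 - 1) := by
  have hx' : x 0 ^ 2 - 1 = x 1 ^ 2 + x 2 ^ 2 + x 3 ^ 2 := by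
    simp only [mink] at hx; linarith
  have hy' : y 0 ^ 2 - 1 = y 1 ^ 2 + y 2 ^ 2 + y 3 ^ 2 := by
    simp only [mink] at hy; linarith
  rw [hx', hy']
  simp only [mink]
  -- Lagrange's identity: the difference of the two sides is the sum of these squares.
  nlinarith [sq_nonneg (x 1 * y 2 - x 2 * y 1), sq_nonneg (x 1 * y 3 - x 3 * y 1),
    sq_nonneg (x 2 * y 3 - x 3 * y 2)]

lemma one_le_sq_time {x : Fin 4 → ℝ} (hx : mink x x = -1) : 1 ≤ x 0 ^ 2 := by
  simp only [mink] at hx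
  nlinarith [sq_nonneg (x 1), sq_nonneg (x 2), sq_nonneg (x 3)]

lemma one_le_neg_mink (x y : HypSpace) : 1 ≤ -mink x.1 y.1 := by
  obtain ⟨x, hx, hx0⟩ := x
  obtain ⟨y, hy, hy0⟩ := y
  have h := spatial_cauchy_schwarz hx hy
  have h1 := one_le_sq_time hx
  have h2 := one_le_sq_time hy
  have h3 : 1 ≤ x 0 := by nlinarith
  have h4 : 1 ≤ y 0 := by nlinarith
  have h5 : 1 ≤ x 0 * y 0 := by nlinarith
  have h6 : (x 0 ^ 2 - 1) * (y 0 ^ 2 - 1) ≤ (x 0 * y 0 - 1) ^ 2 := by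
    nlinarith [sq_nonneg (x 0 - y 0)]
  have h7 := abs_le_of_sq_le_sq' (h.trans h6) (by linarith)
  simp only
  linarith [h7.2]

/-- The sign of the product tells whether two unit timelike vectors lie in the same sheet. In
opposite sheets a negative product would contradict Cauchy–Schwarz for the spatial parts. -/
lemma time_pos_of_mink_neg {x y : Fin 4 → ℝ} (hx : mink x x = -1) (hy : mink y y = -1)
    (hy0 : 0 < y 0) (h : mink x y < 0) : 0 < x 0 := by
  by_contra hx0
  push Not at hx0
  have h1 := spatial_cauchy_schwarz hx hy
  have h2 := one_le_sq_time hx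
  have h3 := one_le_sq_time hy
  have h4 : x 0 * y 0 ≤ 0 := mul_nonpos_of_nonpos_of_nonneg hx0 hy0.le
  have h5 : (x 0 * y 0) ^ 2 ≤ (mink x y + x 0 * y 0) ^ 2 := by nlinarith
  nlinarith

lemma cosh_hdist (x y : HypSpace) : Real.cosh (hdist x y) = -mink x.1 y.1 :=
  Real.cosh_arcosh (one_le_neg_mink x y)

lemma exists_complementary_pair :
    ∀ i j : Fin 4, i ≠ j → ∃ k h, i ≠ k ∧ i ≠ h ∧ j ≠ k ∧ j ≠ h ∧ k ≠ h := by decide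

/-! ### The Gram matrix of the unit normals of the vertex triangles -/

namespace HyperIdealTetrahedron

variable (P : HyperIdealTetrahedron)

/-- The unit normal of the plane of the vertex triangle `Δ_i`. -/
noncomputable def unitNormal (i : Fin 4) : Fin 4 → ℝ :=
  (√(mink (P.truncNormal i) (P.truncNormal i)))⁻¹ • P.truncNormal i

lemma sqrt_truncNormal_pos (i : Fin 4) : 0 < (√(mink (P.truncNormal i) (P.truncNormal i)))⁻¹ :=
  inv_pos.2 (Real.sqrt_pos.2 (P.truncNormal_spacelike i))

lemma mink_unitNormal_self (i : Fin 4) : mink (P.unitNormal i) (P.unitNormal i) = 1 := by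
  have h := P.truncNormal_spacelike i
  have h' := Real.sq_sqrt h.le
  have h'' := Real.sqrt_pos.2 h
  simp only [unitNormal, mink_smul_left, mink_smul_right]
  field_simp
  exact h'.symm

lemma mink_unitNormal_corner_eq {i j : Fin 4} (hij : i ≠ j) :
    mink (P.unitNormal i) (P.corner i j).1 = 0 := by
  simp [unitNormal, P.trunc_corner_eq i j hij]

lemma mink_unitNormal_corner_neg {i j k : Fin 4} (hjk : j ≠ k) (hji : j ≠ i) :
    mink (P.unitNormal i) (P.corner j k).1 < 0 := by
  rw [unitNormal, mink_smul_left]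
  exact mul_neg_of_pos_of_neg (P.sqrt_truncNormal_pos i) (P.trunc_corner_neg i j k hjk hji)

lemma mink_unitNormal_faceNormal {i h : Fin 4} (hih : i ≠ h) :
    mink (P.unitNormal i) (P.faceNormal h) = 0 := by
  simp [unitNormal, P.orthogonal i h hih]

/-- A vector tangent to the line of the edge `{ij}` is a combination of the unit normal of `Δ_i`
and of the corner of the edge at `Δ_i`. -/
lemma eq_of_mink_faceNormal_eq_zero {i j k h : Fin 4} (hij : i ≠ j) (hik : i ≠ k) (hih : i ≠ h)
    (hjk : j ≠ k) (hjh : j ≠ h) (hkh : k ≠ h) {u : Fin 4 → ℝ} (huk : mink u (P.faceNormal k) = 0)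
    (huh : mink u (P.faceNormal h) = 0) :
    u = mink u (P.unitNormal i) • P.unitNormal i - mink u (P.corner i j).1 • (P.corner i j).1 := by
  have nn := P.mink_unitNormal_self i
  have nc := P.mink_unitNormal_corner_eq hij
  have cn := mink_comm _ _ ▸ nc
  have nk := P.mink_unitNormal_faceNormal hik
  have nh := P.mink_unitNormal_faceNormal hih
  have kn := mink_comm _ _ ▸ nk
  have hn := mink_comm _ _ ▸ nh
  have cc := (P.corner i j).2.1
  have kc := P.face_corner_eq k i j hij hik.symm hjk.symm
  have hc := P.face_corner_eq h i j hij hih.symm hjh.symm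
  have ck := mink_comm _ _ ▸ kc
  have ch := mink_comm _ _ ▸ hc
  -- Pairing with n_i and the corner (i,j), which are orthogonal to the other three vectors, kills
  -- the first two coefficients. The corners (k,j) and (h,j) each lie on exactly one of the faces
  -- opposite to k and h, which kills the other two.
  have hind : LinearIndependent ℝ
      ![P.unitNormal i, (P.corner i j).1, P.faceNormal k, P.faceNormal h] := by
    rw [Fintype.linearIndependent_iff]
    intro g hg
    simp only [Fin.sum_univ_four, Matrix.cons_val] at hg
    have e0 := congrArg (fun v => mink v (P.unitNormal i)) hg
    have e1 := congrArg (fun v => mink v (P.corner i j).1) hg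
    have g0 : g 0 = 0 := by simpa [nn, cn, kn, hn] using e0
    have g1 : g 1 = 0 := by simpa [nc, cc, kc, hc] using e1
    have e2 := congrArg (fun v => mink v (P.corner k j).1) hg
    have e3 := congrArg (fun v => mink v (P.corner h j).1) hg
    have g2 : g 2 = 0 := by
      simpa [g0, g1, P.face_corner_eq h k j hjk.symm hkh.symm hjh.symm,
        (P.face_corner_neg k k j hjk.symm (Or.inl rfl)).ne] using e2
    have g3 : g 3 = 0 := by
      simpa [g0, g1, P.face_corner_eq k h j hjh.symm hkh hjk.symm,
        (P.face_corner_neg h h j hjh.symm (Or.inl rfl)).ne] using e3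
    intro a
    fin_cases a <;> assumption
  rw [← sub_eq_zero]
  refine eq_zero_of_mink_indep hind fun a => ?_
  fin_cases a
  · simp [nn, cn]
  · simp [nc, cc]
  · simp [huk, nk, ck]
  · simp [huh, nh, ch]

/-- Both (n_i, c_ij) and (n_j, c_ji) are orthonormal bases, of type (1,-1), of the Lorentzian plane
containing the edge. The transition matrix between them is fixed by b = ⟨n_j, c_ij⟩ and α = ⟨n_i,
c_ji⟩ being negative: this forces b = α and a = β, where β = -cosh l_ij. -/
lemma one_lt_and_unitNormal_eq {i j : Fin 4} (hij : i ≠ j) :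
    1 < Real.cosh (P.edgeLength i j) ∧
    mink (P.unitNormal i) (P.unitNormal j) = -Real.cosh (P.edgeLength i j) ∧
    P.unitNormal j = -Real.cosh (P.edgeLength i j) • P.unitNormal i +
      √(Real.cosh (P.edgeLength i j) ^ 2 - 1) • (P.corner i j).1 := by
  obtain ⟨k, h, hik, hih, hjk, hjh, hkh⟩ := exists_complementary_pair i j hij
  rw [edgeLength, cosh_hdist]
  have e1 := P.eq_of_mink_faceNormal_eq_zero hij hik hih hjk hjh hkh
    (P.mink_unitNormal_faceNormal hjk) (P.mink_unitNormal_faceNormal hjh)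
  have e2 := P.eq_of_mink_faceNormal_eq_zero hij hik hih hjk hjh hkh
    (mink_comm _ _ ▸ P.face_corner_eq k j i hij.symm hjk.symm hik.symm)
    (mink_comm _ _ ▸ P.face_corner_eq h j i hij.symm hjh.symm hih.symm)
  have nn := P.mink_unitNormal_self i
  have nn' := P.mink_unitNormal_self j
  have nc := P.mink_unitNormal_corner_eq hij
  have nc' := P.mink_unitNormal_corner_eq hij.symm
  have cn := mink_comm _ _ ▸ nc
  have cc := (P.corner i j).2.1
  have cc' := (P.corner j i).2.1
  have hb := P.mink_unitNormal_corner_neg hij hij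
  have hα := P.mink_unitNormal_corner_neg hij.symm hij.symm
  have hβ := one_le_neg_mink (P.corner i j) (P.corner j i)
  rw [mink_comm (P.corner j i).1 (P.unitNormal i),
    mink_comm (P.corner j i).1 (P.corner i j).1] at e2
  rw [mink_comm] at e1
  set a := mink (P.unitNormal i) (P.unitNormal j)
  set b := mink (P.unitNormal j) (P.corner i j).1
  set α := mink (P.unitNormal i) (P.corner j i).1
  set β := mink (P.corner i j).1 (P.corner j i).1
  have f1 : a ^ 2 - b ^ 2 = 1 := by
    rw [e1] at nn'
    simp [nn, nc, cn, cc] at nn'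
    linarith
  have f2 : α ^ 2 - β ^ 2 = -1 := by
    rw [e2] at cc'
    simp [nn, nc, cn, cc] at cc'
    linarith
  have f3 : a * α = b * β := by
    rw [e1] at nc'
    simp only [mink_sub_left, mink_smul_left] at nc'
    linarith
  have f4 : b = α := by
    have : b ^ 2 = α ^ 2 := by
      linear_combination b ^ 2 * f2 - (a * α + b * β) * f3 + α ^ 2 * f1
    nlinarith
  have f5 : a = β := by
    rw [f4, mul_comm] at f3
    exact mul_left_cancel₀ hα.ne f3
  refine ⟨by nlinarith, by linarith, ?_⟩
  have f6 : √((-β) ^ 2 - 1) = -b := by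
    rw [show (-β) ^ 2 - 1 = (-b) ^ 2 by rw [f4]; linarith, Real.sqrt_sq (by linarith)]
  rw [f6, neg_neg, neg_smul, ← sub_eq_add_neg, ← f5]
  exact e1

/-- The face normals are dual to the n_i up to scale: by orthogonality only n_h pairs nontrivially
with the normal of the face opposite to h. Were that pairing zero too, the corners at Δ_h would lie
on this face. -/
lemma linearIndependent_unitNormal : LinearIndependent ℝ P.unitNormal := by
  rw [Fintype.linearIndependent_iff]
  intro g hg h
  have hne : mink (P.unitNormal h) (P.faceNormal h) ≠ 0 := by
    intro h0
    obtain ⟨j, hj⟩ := exists_ne h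
    obtain ⟨_, _, e⟩ := P.one_lt_and_unitNormal_eq hj.symm
    have e' := congrArg (fun v => mink v (P.faceNormal h)) e
    have hneg := P.face_corner_neg h h j hj.symm (Or.inl rfl)
    rw [mink_comm] at hneg
    simp only [mink_add_left, mink_smul_left, h0, P.mink_unitNormal_faceNormal hj, mul_zero,
      zero_add] at e'
    have h1 := (P.one_lt_and_unitNormal_eq hj.symm).1
    exact (mul_neg_of_pos_of_neg (Real.sqrt_pos.2 (by nlinarith)) hneg).ne e'.symm
  have e := congrArg (fun v => mink v (P.faceNormal h)) hg
  simp only [mink_sum_left, mink_smul_left, mink_zero_left] at e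
  rw [Finset.sum_eq_single h (fun b _ hb => by rw [P.mink_unitNormal_faceNormal hb, mul_zero])
    (by simp)] at e
  exact (mul_eq_zero.1 e).resolve_right hne

lemma corner_eq {i j : Fin 4} (hij : i ≠ j) :
    (P.corner i j).1 = (√(Real.cosh (P.edgeLength i j) ^ 2 - 1))⁻¹ •
      (P.unitNormal j + Real.cosh (P.edgeLength i j) • P.unitNormal i) := by
  obtain ⟨h1, _, e⟩ := P.one_lt_and_unitNormal_eq hij
  have hs : √(Real.cosh (P.edgeLength i j) ^ 2 - 1) ≠ 0 :=
    (Real.sqrt_pos.2 (by nlinarith)).ne'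
  rw [e, neg_smul, neg_add_eq_sub, sub_add_cancel, smul_smul, inv_mul_cancel₀ hs, one_smul]

/-! ### Uniqueness -/

/-- A linear isometry of Minkowski space preserving the upper sheet induces a bijection of
hyperbolic space. -/
noncomputable def _root_.HyperIdeal.hypEquiv (A : (Fin 4 → ℝ) ≃ₗ[ℝ] (Fin 4 → ℝ))
    (hA : ∀ x y, mink (A x) (A y) = mink x y) (c : HypSpace) (hc : 0 < A c.1 0) :
    HypSpace ≃ HypSpace where
  toFun x := ⟨A x.1, by rw [hA, x.2.1], time_pos_of_mink_neg (by rw [hA, x.2.1])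
    (by rw [hA, c.2.1]) hc (by rw [hA]; linarith [one_le_neg_mink x c])⟩
  invFun x := by
    have hA' : ∀ x y, mink (A.symm x) (A.symm y) = mink x y := fun x y => by
      rw [← hA, A.apply_symm_apply, A.apply_symm_apply]
    refine ⟨A.symm x.1, by rw [hA', x.2.1], time_pos_of_mink_neg (y := c.1) (by rw [hA', x.2.1])
      c.2.1 c.2.2 ?_⟩
    rw [← hA, A.apply_symm_apply]
    have := one_le_neg_mink x ⟨A c.1, by rw [hA, c.2.1], hc⟩
    simp only at this
    linarith
  left_inv x := Subtype.ext (A.symm_apply_apply x.1)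
  right_inv x := Subtype.ext (A.apply_symm_apply x.1)

/-- The linear map taking normals to normals preserves the Gram matrix, hence the form. It takes
corners to corners, since these are the same combinations of normals, and linear maps commute with
convex hulls. -/
lemma congruent_of_edgeLength_eq {P P' : HyperIdealTetrahedron}
    (h : ∀ i j, i ≠ j → P.edgeLength i j = P'.edgeLength i j) : P.Congruent P' := by
  let b := basisOfIndep P.linearIndependent_unitNormal
  let b' := basisOfIndep P'.linearIndependent_unitNormal
  let A := b.equiv b' (Equiv.refl _)
  have hAn : ∀ i, A (P.unitNormal i) = P'.unitNormal i := fun i => by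
    have := b.equiv_apply (b' := b') (e := Equiv.refl _) (i := i)
    simpa [b, b'] using this
  have hA : ∀ x y, mink (A x) (A y) = mink x y := by
    have : minkForm.compl₁₂ (A : (Fin 4 → ℝ) →ₗ[ℝ] (Fin 4 → ℝ)) A = minkForm := by
      refine LinearMap.ext_basis b b fun i j => ?_
      simp only [b, basisOfIndep_apply, LinearMap.compl₁₂_apply, LinearEquiv.coe_coe, hAn,
        minkForm_apply]
      by_cases hij : i = j
      · subst hij; rw [mink_unitNormal_self, mink_unitNormal_self]
      · rw [(P.one_lt_and_unitNormal_eq hij).2.1, (P'.one_lt_and_unitNormal_eq hij).2.1, h i j hij]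
    intro x y
    exact LinearMap.congr_fun (LinearMap.congr_fun this x) y
  have hAc : ∀ i j, i ≠ j → A (P.corner i j).1 = (P'.corner i j).1 := fun i j hij => by
    rw [P.corner_eq hij, P'.corner_eq hij, ← h i j hij]
    simp only [map_smul, map_add, hAn]
  have h01 : (0 : Fin 4) ≠ 1 := by decide
  let φ := hypEquiv A hA (P.corner 0 1) (by rw [hAc 0 1 h01]; exact (P'.corner 0 1).2.2)
  have hφ : ∀ x, (φ x).1 = A x.1 := fun x => rfl
  have hφc : ∀ i j, i ≠ j → φ (P.corner i j) = P'.corner i j :=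
    fun i j hij => Subtype.ext (hAc i j hij)
  refine ⟨φ, fun x y => by simp only [hdist, hφ, hA], ?_, hφc⟩
  have himg : A '' (Subtype.val '' {x | ∃ i j, i ≠ j ∧ x = P.corner i j}) =
      Subtype.val '' {x | ∃ i j, i ≠ j ∧ x = P'.corner i j} := by
    ext v
    constructor
    · rintro ⟨_, ⟨_, ⟨i, j, hij, rfl⟩, rfl⟩, rfl⟩
      exact ⟨_, ⟨i, j, hij, rfl⟩, (hAc i j hij).symm⟩
    · rintro ⟨_, ⟨i, j, hij, rfl⟩, rfl⟩
      exact ⟨_, ⟨_, ⟨i, j, hij, rfl⟩, rfl⟩, hAc i j hij⟩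
  have hhull : ∀ v, A v ∈ convexHull ℝ (Subtype.val '' {x | ∃ i j, i ≠ j ∧ x = P'.corner i j}) ↔
      v ∈ convexHull ℝ (Subtype.val '' {x | ∃ i j, i ≠ j ∧ x = P.corner i j}) := fun v => by
    rw [← himg]
    have := (A : (Fin 4 → ℝ) →ₗ[ℝ] (Fin 4 → ℝ)).image_convexHull
      (Subtype.val '' {x | ∃ i j, i ≠ j ∧ x = P.corner i j})
    simp only [LinearEquiv.coe_coe] at this
    rw [← this]
    exact A.injective.mem_set_image
  ext x
  rw [Equiv.image_eq_preimage_symm, Set.mem_preimage]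
  obtain ⟨y, rfl⟩ := φ.surjective x
  rw [Equiv.symm_apply_apply]
  refine exists_congr fun c => and_congr_right fun _ => ?_
  refine (hhull (c • y.1)).symm.trans ?_
  rw [map_smul]
  exact Iff.rfl

/-! ### The sides of the vertex triangles -/

/-- Law of cosines in the right-angled hexagon {ijk}, obtained by pairing two corners expressed in
normals. -/
lemma cosh_vertexEdgeLength {i j k : Fin 4} (hij : i ≠ j) (hik : i ≠ k) (hjk : j ≠ k) :
    Real.cosh (P.vertexEdgeLength i j k) =
      (Real.cosh (P.edgeLength j k) + Real.cosh (P.edgeLength i j) * Real.cosh (P.edgeLength i k)) /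
      (√(Real.cosh (P.edgeLength i j) ^ 2 - 1) * √(Real.cosh (P.edgeLength i k) ^ 2 - 1)) := by
  rw [vertexEdgeLength, cosh_hdist, P.corner_eq hij, P.corner_eq hik]
  have h1 := (P.one_lt_and_unitNormal_eq hij).2.1
  have h2 := (P.one_lt_and_unitNormal_eq hik).2.1
  have h3 := (P.one_lt_and_unitNormal_eq hjk).2.1
  have h1' := mink_comm _ _ ▸ h1
  simp only [mink_smul_left, mink_smul_right, mink_add_left, mink_add_right, h1', h2, h3,
    mink_unitNormal_self, div_eq_mul_inv, mul_inv]
  ring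

end HyperIdealTetrahedron
/-! ### The polynomial `Q₂` -/

lemma sum_eq_of_distinct (f : Fin 4 → ℝ) {i j k h : Fin 4} (hij : i ≠ j) (hik : i ≠ k)
    (hih : i ≠ h) (hjk : j ≠ k) (hjh : j ≠ h) (hkh : k ≠ h) :
    ∑ a, f a = f i + f j + f k + f h := by
  have hu : (Finset.univ : Finset (Fin 4)) = {i, j, k, h} := by
    symm
    rw [← Finset.card_eq_iff_eq_univ, Fintype.card_fin]
    simp [Finset.card_insert_of_notMem, *]
  rw [hu]
  simp [Finset.sum_insert, *, add_assoc]

lemma Q₂_pos {t : Fin 4 → ℝ} (ht : ∀ i, t i ∈ Set.Ioo (0 : ℝ) 1) : 0 < Q₂ t := by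
  obtain ⟨a0, a1⟩ := ht 0
  obtain ⟨b0, b1⟩ := ht 1
  obtain ⟨c0, c1⟩ := ht 2
  obtain ⟨d0, d1⟩ := ht 3
  simp only [Q₂, Fin.sum_univ_four]
  have h1 : t 0 ^ 2 + t 1 ^ 2 + t 2 ^ 2 + t 3 ^ 2 < 4 := by nlinarith
  have h2 : 0 ≤ (1 - t 0) * (1 - t 1) := mul_nonneg (by linarith) (by linarith)
  have h3 : 0 ≤ (1 - t 2) * (1 - t 3) := mul_nonneg (by linarith) (by linarith)
  have h4 : 0 ≤ (t 0 + t 1) * (t 2 + t 3) := by positivity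
  nlinarith [mul_pos a0 b0, mul_pos c0 d0, mul_pos a0 c0, mul_pos a0 d0, mul_pos b0 c0,
    mul_pos b0 d0]

lemma tanh_mem_Ioo {x : ℝ} (hx : 0 < x) : Real.tanh x ∈ Set.Ioo (0 : ℝ) 1 := by
  rw [Real.tanh_eq_sinh_div_cosh]
  exact ⟨div_pos (Real.sinh_pos_iff.2 hx) (Real.cosh_pos x),
    (div_lt_one (Real.cosh_pos x)).2 (Real.sinh_lt_cosh x)⟩

/-! ### The triangle inequality identity -/

/-- With x, y, z the sides of Δ_i, the right side is minus the Gram determinant of its three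
corners. Product-to-sum is applied to the outer and to the inner pair of factors. -/
lemma four_mul_sinh_mul_sinh (x y z : ℝ) :
    4 * Real.sinh ((x + y + z) / 2) * Real.sinh ((x + y - z) / 2) *
      Real.sinh ((x - y + z) / 2) * Real.sinh ((-x + y + z) / 2) =
    1 + 2 * Real.cosh x * Real.cosh y * Real.cosh z -
      Real.cosh x ^ 2 - Real.cosh y ^ 2 - Real.cosh z ^ 2 := by
  have key : ∀ u v : ℝ, 2 * Real.sinh u * Real.sinh v = Real.cosh (u + v) - Real.cosh (u - v) :=
    fun u v => by rw [Real.cosh_add, Real.cosh_sub]; ring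
  have h1 := key ((x + y + z) / 2) ((-x + y + z) / 2)
  have h2 := key ((x + y - z) / 2) ((x - y + z) / 2)
  rw [show (x + y + z) / 2 + (-x + y + z) / 2 = y + z by ring,
    show (x + y + z) / 2 - (-x + y + z) / 2 = x by ring, Real.cosh_add] at h1
  rw [show (x + y - z) / 2 + (x - y + z) / 2 = x by ring,
    show (x + y - z) / 2 - (x - y + z) / 2 = y - z by ring, Real.cosh_sub] at h2
  have hy := Real.sinh_sq y
  have hz := Real.sinh_sq z
  calc _ = (2 * Real.sinh ((x + y + z) / 2) * Real.sinh ((-x + y + z) / 2)) *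
        (2 * Real.sinh ((x + y - z) / 2) * Real.sinh ((x - y + z) / 2)) := by ring
    _ = Real.sinh y ^ 2 * Real.sinh z ^ 2 -
        (Real.cosh y * Real.cosh z - Real.cosh x) ^ 2 := by rw [h1, h2]; ring
    _ = _ := by rw [hy, hz]; ring

/-- Schur complement of the Gram matrix of a hyper-ideal tetrahedron. -/
lemma schur_complement_gram (a b c d e f : ℝ) :
    (a ^ 2 - 1) * (b ^ 2 - 1) * (c ^ 2 - 1) + 2 * (d + a * b) * (e + a * c) * (f + b * c) -
      (d + a * b) ^ 2 * (c ^ 2 - 1) - (e + a * c) ^ 2 * (b ^ 2 - 1) -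
      (f + b * c) ^ 2 * (a ^ 2 - 1) =
    -1 + a ^ 2 + b ^ 2 + c ^ 2 + d ^ 2 + e ^ 2 + f ^ 2 + 2 * (a * b * d) + 2 * (a * c * e) +
      2 * (b * c * f) + 2 * (d * e * f) + 2 * (a * b * e * f) + 2 * (a * c * d * f) +
      2 * (b * c * d * e) - a ^ 2 * f ^ 2 - b ^ 2 * e ^ 2 - c ^ 2 * d ^ 2 := by
  ring

/-- The determinant of `2 diag(Aᵢ²) - A Aᵀ - B Bᵀ`, up to sign. -/
lemma neg_det_gram_eq {A B C D a b c d : ℝ} (hA : A ^ 2 = 1 + a ^ 2) (hB : B ^ 2 = 1 + b ^ 2)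
    (hC : C ^ 2 = 1 + c ^ 2) (hD : D ^ 2 = 1 + d ^ 2) :
    -1 + (A * B + a * b) ^ 2 + (A * C + a * c) ^ 2 + (A * D + a * d) ^ 2 +
      (B * C + b * c) ^ 2 + (B * D + b * d) ^ 2 + (C * D + c * d) ^ 2 +
      2 * ((A * B + a * b) * (A * C + a * c) * (B * C + b * c)) +
      2 * ((A * B + a * b) * (A * D + a * d) * (B * D + b * d)) +
      2 * ((A * C + a * c) * (A * D + a * d) * (C * D + c * d)) +
      2 * ((B * C + b * c) * (B * D + b * d) * (C * D + c * d)) +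
      2 * ((A * B + a * b) * (A * C + a * c) * (B * D + b * d) * (C * D + c * d)) +
      2 * ((A * B + a * b) * (A * D + a * d) * (B * C + b * c) * (C * D + c * d)) +
      2 * ((A * C + a * c) * (A * D + a * d) * (B * C + b * c) * (B * D + b * d)) -
      (A * B + a * b) ^ 2 * (C * D + c * d) ^ 2 - (A * C + a * c) ^ 2 * (B * D + b * d) ^ 2 -
      (A * D + a * d) ^ 2 * (B * C + b * c) ^ 2 =
    4 * ((a * B * C * D + A * b * C * D + A * B * c * D + A * B * C * d) ^ 2 -
      2 * ((a * B * C * D) ^ 2 + (A * b * C * D) ^ 2 + (A * B * c * D) ^ 2 +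
        (A * B * C * d) ^ 2) + 4 * (A * B * C * D) ^ 2) := by
  have gA : A ^ 2 - a ^ 2 = 1 := by linarith
  have gB : B ^ 2 - b ^ 2 = 1 := by linarith
  have gC : C ^ 2 - c ^ 2 = 1 := by linarith
  have gD : D ^ 2 - d ^ 2 = 1 := by linarith
  -- Homogenization: with suitable 1's replaced by A² - a², and so on, the identity holds without
  -- constraints on the variables.
  have hom : ∀ gA gB gC gD : ℝ, gA = A ^ 2 - a ^ 2 → gB = B ^ 2 - b ^ 2 → gC = C ^ 2 - c ^ 2 →
      gD = D ^ 2 - d ^ 2 →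
      -(gA * gB * gC * gD) + gC * gD * (A * B + a * b) ^ 2 + gB * gD * (A * C + a * c) ^ 2 +
      gB * gC * (A * D + a * d) ^ 2 +
      gA * gD * (B * C + b * c) ^ 2 + gA * gC * (B * D + b * d) ^ 2 +
      gA * gB * (C * D + c * d) ^ 2 +
      2 * (gD * (A * B + a * b) * (A * C + a * c) * (B * C + b * c)) +
      2 * (gC * (A * B + a * b) * (A * D + a * d) * (B * D + b * d)) +
      2 * (gB * (A * C + a * c) * (A * D + a * d) * (C * D + c * d)) +
      2 * (gA * (B * C + b * c) * (B * D + b * d) * (C * D + c * d)) +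
      2 * ((A * B + a * b) * (A * C + a * c) * (B * D + b * d) * (C * D + c * d)) +
      2 * ((A * B + a * b) * (A * D + a * d) * (B * C + b * c) * (C * D + c * d)) +
      2 * ((A * C + a * c) * (A * D + a * d) * (B * C + b * c) * (B * D + b * d)) -
      (A * B + a * b) ^ 2 * (C * D + c * d) ^ 2 - (A * C + a * c) ^ 2 * (B * D + b * d) ^ 2 -
      (A * D + a * d) ^ 2 * (B * C + b * c) ^ 2 =
    4 * ((a * B * C * D + A * b * C * D + A * B * c * D + A * B * C * d) ^ 2 -
      2 * ((a * B * C * D) ^ 2 + (A * b * C * D) ^ 2 + (A * B * c * D) ^ 2 +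
        (A * B * C * d) ^ 2) + 4 * (A * B * C * D) ^ 2) := by
    rintro _ _ _ _ rfl rfl rfl rfl
    ring
  simpa using hom 1 1 1 1 gA.symm gB.symm gC.symm gD.symm

/-- The vectors sinh l_ij · c_ij are the projections of the n_j orthogonally to n_i, so the Gram
determinant of the normals is that of the three corners at Δ_i times the squared sinh's. The
factorization in tanh evaluates the same determinant. -/
lemma HyperIdealTetrahedron.sinh_identity {r : Fin 4 → ℝ} (hr : ∀ i, 0 < r i)
    (P : HyperIdealTetrahedron) (hP : P.HasEdgeLengths (fun i j => r i + r j))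
    {i j k h : Fin 4} (hij : i ≠ j) (hik : i ≠ k) (hih : i ≠ h) (hjk : j ≠ k) (hjh : j ≠ h)
    (hkh : k ≠ h) {x y z : ℝ} (hx : x = P.vertexEdgeLength i j k)
    (hy : y = P.vertexEdgeLength i j h) (hz : z = P.vertexEdgeLength i k h) :
    4 * Real.sinh ((x + y + z) / 2) * Real.sinh ((x + y - z) / 2) *
        Real.sinh ((x - y + z) / 2) * Real.sinh ((-x + y + z) / 2) =
      4 * (Real.cosh (r i) * Real.cosh (r j) * Real.cosh (r k) * Real.cosh (r h)) ^ 2 /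
        (Real.sinh (r i + r j) * Real.sinh (r i + r k) * Real.sinh (r i + r h)) ^ 2 *
        Q₂ (fun a => Real.tanh (r a)) := by
  have hsqrt : ∀ a b, √(Real.cosh (r a + r b) ^ 2 - 1) = Real.sinh (r a + r b) := fun a b => by
    rw [← Real.sinh_sq, Real.sqrt_sq (Real.sinh_pos_iff.2 (add_pos (hr a) (hr b))).le]
  rw [four_mul_sinh_mul_sinh, hx, hy, hz, P.cosh_vertexEdgeLength hij hik hjk,
    P.cosh_vertexEdgeLength hij hih hjh, P.cosh_vertexEdgeLength hik hih hkh,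
    hP i j hij, hP i k hik, hP i h hih, hP j k hjk, hP j h hjh, hP k h hkh]
  simp only [hsqrt]
  have hp := Real.sinh_pos_iff.2 (add_pos (hr i) (hr j))
  have hq := Real.sinh_pos_iff.2 (add_pos (hr i) (hr k))
  have hs := Real.sinh_pos_iff.2 (add_pos (hr i) (hr h))
  have hp2 := Real.sinh_sq (r i + r j)
  have hq2 := Real.sinh_sq (r i + r k)
  have hs2 := Real.sinh_sq (r i + r h)
  have key := schur_complement_gram (Real.cosh (r i + r j)) (Real.cosh (r i + r k))
    (Real.cosh (r i + r h)) (Real.cosh (r j + r k)) (Real.cosh (r j + r h)) (Real.cosh (r k + r h))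
  rw [← hp2, ← hq2, ← hs2] at key
  have hdet := neg_det_gram_eq (Real.cosh_sq' (r i)) (Real.cosh_sq' (r j)) (Real.cosh_sq' (r k))
    (Real.cosh_sq' (r h))
  simp only [← Real.cosh_add] at hdet
  rw [hdet] at key
  have hQ : (Real.cosh (r i) * Real.cosh (r j) * Real.cosh (r k) * Real.cosh (r h)) ^ 2 *
      Q₂ (fun a => Real.tanh (r a)) =
      (Real.sinh (r i) * Real.cosh (r j) * Real.cosh (r k) * Real.cosh (r h) +
        Real.cosh (r i) * Real.sinh (r j) * Real.cosh (r k) * Real.cosh (r h) +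
        Real.cosh (r i) * Real.cosh (r j) * Real.sinh (r k) * Real.cosh (r h) +
        Real.cosh (r i) * Real.cosh (r j) * Real.cosh (r k) * Real.sinh (r h)) ^ 2 -
      2 * ((Real.sinh (r i) * Real.cosh (r j) * Real.cosh (r k) * Real.cosh (r h)) ^ 2 +
        (Real.cosh (r i) * Real.sinh (r j) * Real.cosh (r k) * Real.cosh (r h)) ^ 2 +
        (Real.cosh (r i) * Real.cosh (r j) * Real.sinh (r k) * Real.cosh (r h)) ^ 2 +
        (Real.cosh (r i) * Real.cosh (r j) * Real.cosh (r k) * Real.sinh (r h)) ^ 2) +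
      4 * (Real.cosh (r i) * Real.cosh (r j) * Real.cosh (r k) * Real.cosh (r h)) ^ 2 := by
    have ht : ∀ a, Real.sinh (r a) = Real.tanh (r a) * Real.cosh (r a) := fun a => by
      rw [Real.tanh_eq_sinh_div_cosh, div_mul_cancel₀ _ (Real.cosh_pos _).ne']
    rw [Q₂, sum_eq_of_distinct _ hij hik hih hjk hjh hkh,
      sum_eq_of_distinct _ hij hik hih hjk hjh hkh]
    simp only [ht]
    ring
  rw [← hQ] at key
  generalize Q₂ (fun a => Real.tanh (r a)) = Q at *
  generalize Real.sinh (r i + r j) = p at *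
  generalize Real.sinh (r i + r k) = q at *
  generalize Real.sinh (r i + r h) = s at *
  generalize Real.cosh (r i + r j) = a at *
  generalize Real.cosh (r i + r k) = b at *
  generalize Real.cosh (r i + r h) = c at *
  generalize Real.cosh (r j + r k) = d at *
  generalize Real.cosh (r j + r h) = e at *
  generalize Real.cosh (r k + r h) = f at *
  generalize Real.cosh (r i) * Real.cosh (r j) * Real.cosh (r k) * Real.cosh (r h) = M at *
  rw [div_mul_eq_mul_div, eq_div_iff (by positivity), mul_assoc 4 _ Q, ← key]
  field_simp

/-! ### Existence -/

/-- Four vectors of Minkowski space with a prescribed Gram matrix, and vectors proportional to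
their dual basis. -/
lemma exists_gram_and_dual {t : Fin 4 → ℝ} (ht : ∀ i, 0 < t i) (hQ : 0 < Q₂ t) :
    ∃ w f : Fin 4 → Fin 4 → ℝ,
      (∀ i j, mink (w i) (w j) = (if i = j then 2 else 0) - 1 - t i * t j) ∧
      (∀ h i, h ≠ i → mink (f h) (w i) = 0) ∧ (∀ h, mink (f h) (w h) < 0) ∧
      ∀ h, 0 < mink (f h) (f h) := by
  obtain ⟨w, hw⟩ : ∃ w : Fin 4 → Fin 4 → ℝ,
      ∀ i j, mink (w i) (w j) = (if i = j then 2 else 0) - 1 - t i * t j := by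
    -- The rows `y i` are vertices of a centred regular tetrahedron; preceded by 1/2 they form an
    -- orthogonal matrix. In these coordinates 2I - 11ᵀ - ttᵀ has time entry -m, and completing the
    -- square leaves 2(|x|² - (τ·x)²/m) on the spatial part. It is positive definite because T =
    -- |τ|² < m is equivalent to Q₂ > 0.
    let s : ℝ := ∑ i, t i
    let m : ℝ := 2 + s ^ 2 / 4
    have hm : 0 < m := by positivity
    let y : Fin 4 → Fin 3 → ℝ := ![![1/2, 1/2, 1/2], ![1/2, -1/2, -1/2], ![-1/2, 1/2, -1/2],
      ![-1/2, -1/2, 1/2]]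
    let τ : Fin 3 → ℝ := fun a => ∑ i, t i * y i a
    let T : ℝ := τ 0 ^ 2 + τ 1 ^ 2 + τ 2 ^ 2
    have hT : T = ∑ i, t i ^ 2 - s ^ 2 / 4 := by
      simp [T, τ, y, s, Fin.sum_univ_four]; ring
    have hTm : 0 ≤ 1 - T / m := by
      rw [sub_nonneg, div_le_one hm, hT]
      simp only [Q₂] at hQ
      simp only [m, s]
      linarith
    let u : ℝ := √(1 - T / m)
    have hu : T = m * (1 - u ^ 2) := by
      simp only [u, Real.sq_sqrt hTm]; field_simp; ring
    have hu0 : 0 ≤ u := Real.sqrt_nonneg _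
    -- I - κττᵀ is a square root of I - ττᵀ/m. Here κ is (1 - u)/T, rationalized because T may
    -- vanish.
    let κ : ℝ := 1 / (m * (1 + u))
    have hκ : 2 * κ - κ ^ 2 * T = 1 / m := by
      have : 1 + u ≠ 0 := by positivity
      rw [hu]; simp only [κ]; field_simp; ring
    have hy : ∀ i j, y i 0 * y j 0 + y i 1 * y j 1 + y i 2 * y j 2 =
        (if i = j then 1 else 0) - 1 / 4 := by
      intro i j
      fin_cases i <;> fin_cases j <;> simp [y] <;> norm_num
    have hp : ∀ i, τ 0 * y i 0 + τ 1 * y i 1 + τ 2 * y i 2 = t i - s / 4 := by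
      intro i
      fin_cases i <;> simp [τ, y, s, Fin.sum_univ_four] <;> ring
    refine ⟨fun i => ![√m * (1 / 2 + s / 2 * (t i - s / 4) / m),
      √2 * (y i 0 - κ * (t i - s / 4) * τ 0), √2 * (y i 1 - κ * (t i - s / 4) * τ 1),
      √2 * (y i 2 - κ * (t i - s / 4) * τ 2)], fun i j => ?_⟩
    have h2 : √2 ^ 2 = (2 : ℝ) := Real.sq_sqrt (by norm_num)
    have hm2 : √m ^ 2 = m := Real.sq_sqrt hm.le
    have hmm : m * (1 / m) = 1 := by field_simp
    have hms : s ^ 2 / 4 = m - 2 := by simp only [m]; ring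
    have hite : (if i = j then (2 : ℝ) else 0) = 2 * (if i = j then 1 else 0) := by
      split_ifs <;> norm_num
    have e1 := hy i j
    have e2 := hp i
    have e3 := hp j
    have e4 : τ 0 ^ 2 + τ 1 ^ 2 + τ 2 ^ 2 = T := rfl
    rw [hite]
    simp only [mink, Matrix.cons_val]
    generalize (if i = j then (1 : ℝ) else 0) = δ at *
    have split : -(√m * (1 / 2 + s / 2 * (t i - s / 4) / m) *
          (√m * (1 / 2 + s / 2 * (t j - s / 4) / m))) =
        -(m / 4) - s / 4 * (t i + t j - s / 2) -
          (s ^ 2 / 4) * ((t i - s / 4) * (t j - s / 4)) * (1 / m) := by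
      have : √m * √m = m := Real.mul_self_sqrt hm.le
      calc _ = -((√m * √m) * ((1 / 2 + s / 2 * (t i - s / 4) / m) *
          (1 / 2 + s / 2 * (t j - s / 4) / m))) := by ring
        _ = _ := by rw [this]; field_simp; ring
    rw [split, hms]
    generalize 1 / m = n at *
    linear_combination ((y i 0 - κ * (t i - s / 4) * τ 0) * (y j 0 - κ * (t j - s / 4) * τ 0) +
      (y i 1 - κ * (t i - s / 4) * τ 1) * (y j 1 - κ * (t j - s / 4) * τ 1) +
      (y i 2 - κ * (t i - s / 4) * τ 2) * (y j 2 - κ * (t j - s / 4) * τ 2)) * h2 +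
      2 * e1 - 2 * κ * (t j - s / 4) * e2 - 2 * κ * (t i - s / 4) * e3 +
      2 * κ ^ 2 * (t i - s / 4) * (t j - s / 4) * e4 -
      2 * (t i - s / 4) * (t j - s / 4) * hκ - (t i - s / 4) * (t j - s / 4) * hmm + hms / 4
  let s : ℝ := ∑ i, t i
  let q : ℝ := ∑ i, t i ^ 2
  -- 2 Q₂ times the inverse of the Gram matrix, by the Woodbury formula for a rank-two perturbation
  -- of 2I.
  let B : Fin 4 → Fin 4 → ℝ := fun h j =>
    (if h = j then Q₂ t else 0) - 2 * ((1 - q / 2) + s / 2 * (t h + t j) - t h * t j)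
  have hQs : Q₂ t = s ^ 2 - 2 * q + 4 := rfl
  have hfw : ∀ h i, mink (-∑ j, B h j • w j) (w i) = if h = i then -(2 * Q₂ t) else 0 := by
    intro h i
    rw [← neg_one_smul ℝ, mink_smul_left, mink_sum_left]
    simp only [mink_smul_left, hw, B]
    -- Separates the two delta terms from a quadratic in `t j`, so that the sum over j involves only
    -- s and q.
    have : ∀ j, ((if h = j then Q₂ t else 0) - 2 * ((1 - q / 2) + s / 2 * (t h + t j) - t h * t j)) *
        ((if j = i then (2 : ℝ) else 0) - 1 - t j * t i) =
        (if h = j then Q₂ t * ((if j = i then (2 : ℝ) else 0) - 1 - t j * t i) else 0) -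
        (if j = i then 4 * ((1 - q / 2) + s / 2 * (t h + t j) - t h * t j) else 0) +
        (2 * ((1 - q / 2) + s / 2 * t h) +
          (s - 2 * t h + 2 * ((1 - q / 2) + s / 2 * t h) * t i) * t j +
          (s - 2 * t h) * t i * t j ^ 2) := by
      intro j
      split_ifs <;> ring
    simp only [this, Finset.sum_add_distrib, Finset.sum_sub_distrib, Finset.sum_ite_eq,
      Finset.sum_ite_eq', Finset.mem_univ, if_true, ← Finset.mul_sum, Finset.sum_const,
      Finset.card_univ, Fintype.card_fin, nsmul_eq_mul]
    change -1 * (_ - _ + (_ + _ * s + _ * q)) = _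
    rw [hQs]
    split_ifs
    · push_cast; ring
    · push_cast; ring
  refine ⟨w, fun h => -∑ j, B h j • w j, hw, fun h i hi => by rw [hfw, if_neg hi],
    fun h => by rw [hfw, if_pos rfl]; linarith, fun h => ?_⟩
  have hself : mink (-∑ j, B h j • w j) (-∑ j, B h j • w j) = 2 * Q₂ t * B h h := by
    nth_rewrite 2 [← neg_one_smul ℝ]
    rw [mink_smul_right, mink_sum_right]
    simp only [mink_smul_right, hfw, mul_ite, mul_zero, Finset.sum_ite_eq, Finset.mem_univ, if_true]
    ring
  rw [hself]
  refine mul_pos (by linarith) ?_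
  obtain ⟨j, hj⟩ := exists_ne h
  obtain ⟨k, l, hhk, hhl, hjk, hjl, hkl⟩ := exists_complementary_pair h j hj.symm
  have es : s = t h + t j + t k + t l := sum_eq_of_distinct _ hj.symm hhk hhl hjk hjl hkl
  have eq : q = t h ^ 2 + t j ^ 2 + t k ^ 2 + t l ^ 2 :=
    sum_eq_of_distinct _ hj.symm hhk hhl hjk hjl hkl
  -- Positivity of the t's makes this diagonal cofactor positive, hence the face normal spacelike.
  have : B h h = 2 * (t j * t k + t j * t l + t k * t l) + 2 := by
    simp only [B, if_true, hQs, es, eq]; ring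
  rw [this]
  have := ht j
  have := ht k
  have := ht l
  positivity

/-! ### Building a tetrahedron from Gram vectors -/

section Construction

variable {r : Fin 4 → ℝ} {v : Fin 4 → Fin 4 → ℝ}

/-- The corner at `Δ_i` of the edge `{ij}`, in terms of the unit normals `v` of the vertex
triangles. -/
noncomputable def cornerVec (r : Fin 4 → ℝ) (v : Fin 4 → Fin 4 → ℝ) (i j : Fin 4) : Fin 4 → ℝ :=
  (Real.sinh (r i + r j))⁻¹ • (v j + Real.cosh (r i + r j) • v i)

/-- Vectors with the Gram matrix of the unit normals of the vertex triangles of a hyper-ideal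
tetrahedron with edge lengths `r i + r j`. -/
def IsGram (r : Fin 4 → ℝ) (v : Fin 4 → Fin 4 → ℝ) : Prop :=
  ∀ i j, mink (v i) (v j) = if i = j then 1 else -Real.cosh (r i + r j)

lemma mink_cornerVec_self (hr : ∀ i, 0 < r i) (hv : IsGram r v) {i j : Fin 4} (hij : i ≠ j) :
    mink (cornerVec r v i j) (cornerVec r v i j) = -1 := by
  have hs := Real.sinh_pos_iff.2 (add_pos (hr i) (hr j))
  have hc := Real.cosh_sq (r i + r j)
  simp only [cornerVec, mink_smul_left, mink_smul_right, mink_add_left, mink_add_right, hv i, hv j,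
    if_pos, if_neg hij, if_neg hij.symm, add_comm (r j) (r i)]
  field_simp
  linarith

lemma mink_cornerVec_swap (hr : ∀ i, 0 < r i) (hv : IsGram r v) {i j : Fin 4} (hij : i ≠ j) :
    mink (cornerVec r v i j) (cornerVec r v j i) = -Real.cosh (r i + r j) := by
  have hs := Real.sinh_pos_iff.2 (add_pos (hr i) (hr j))
  have hc := Real.cosh_sq (r i + r j)
  simp only [cornerVec, mink_smul_left, mink_smul_right, mink_add_left, mink_add_right, hv i, hv j,
    if_pos, if_neg hij, if_neg hij.symm, add_comm (r j) (r i)]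
  field_simp
  linarith

lemma mink_normal_cornerVec_eq (hv : IsGram r v) {i j : Fin 4} (hij : i ≠ j) :
    mink (v i) (cornerVec r v i j) = 0 := by
  simp [cornerVec, hv i, hij]

lemma mink_normal_cornerVec_neg (hr : ∀ i, 0 < r i) (hv : IsGram r v) {i j k : Fin 4}
    (hjk : j ≠ k) (hji : j ≠ i) : mink (v i) (cornerVec r v j k) < 0 := by
  have hs := Real.sinh_pos_iff.2 (add_pos (hr j) (hr k))
  have hc1 := Real.one_lt_cosh.2 (add_pos (hr j) (hr k)).ne'
  have hc2 := Real.one_lt_cosh.2 (add_pos (hr i) (hr j)).ne'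
  simp only [cornerVec, mink_smul_right, mink_add_right, hv i, if_neg hji.symm]
  refine mul_neg_of_pos_of_neg (inv_pos.2 hs) ?_
  by_cases hik : i = k
  · subst hik
    rw [if_pos rfl, add_comm (r j) (r i)]
    nlinarith
  · rw [if_neg hik]
    nlinarith [Real.cosh_pos (r i + r k)]

/-- Puts all corners in one sheet, so the time coordinate of a single corner decides for all. The
second corner is a positive combination of two normals; each pairs nonpositively with the first
corner, and at most one pairing vanishes. -/
lemma mink_cornerVec_neg (hr : ∀ i, 0 < r i) (hv : IsGram r v) {i j k l : Fin 4}
    (hij : i ≠ j) (hkl : k ≠ l) : mink (cornerVec r v i j) (cornerVec r v k l) < 0 := by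
  have hs := Real.sinh_pos_iff.2 (add_pos (hr k) (hr l))
  have hc := Real.one_lt_cosh.2 (add_pos (hr k) (hr l)).ne'
  rw [cornerVec, cornerVec, ← cornerVec, mink_smul_right, mink_add_right, mink_smul_right,
    mink_comm _ (v l), mink_comm _ (v k)]
  refine mul_neg_of_pos_of_neg (inv_pos.2 hs) ?_
  by_cases hil : i = l
  · subst hil
    rw [mink_normal_cornerVec_eq hv hij]
    nlinarith [mink_normal_cornerVec_neg hr hv hij hkl.symm]
  · have h1 := mink_normal_cornerVec_neg hr hv hij hil
    by_cases hik : i = k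
    · subst hik
      rw [mink_normal_cornerVec_eq hv hij]
      linarith
    · nlinarith [mink_normal_cornerVec_neg hr hv hij hik]

lemma mink_dual_cornerVec_eq {w : Fin 4 → ℝ} {i j : Fin 4} (hi : mink w (v i) = 0)
    (hj : mink w (v j) = 0) : mink w (cornerVec r v i j) = 0 := by
  simp [cornerVec, hi, hj]

lemma mink_dual_cornerVec_neg (hr : ∀ i, 0 < r i) {f : Fin 4 → Fin 4 → ℝ}
    (hf0 : ∀ h i, h ≠ i → mink (f h) (v i) = 0) (hf1 : ∀ h, mink (f h) (v h) < 0) {h i j : Fin 4}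
    (hij : i ≠ j) (hh : h = i ∨ h = j) : mink (f h) (cornerVec r v i j) < 0 := by
  have hs := Real.sinh_pos_iff.2 (add_pos (hr i) (hr j))
  simp only [cornerVec, mink_smul_right, mink_add_right]
  refine mul_neg_of_pos_of_neg (inv_pos.2 hs) ?_
  rcases hh with rfl | rfl
  · rw [hf0 h j hij, zero_add]
    exact mul_neg_of_pos_of_neg (Real.cosh_pos _) (hf1 h)
  · rw [hf0 h i hij.symm, mul_zero, add_zero]
    exact hf1 h

/-- `cornerVec r v i j` as a point of hyperbolic space if `i ≠ j`. -/
noncomputable def cornerPoint (hr : ∀ i, 0 < r i) (hv : IsGram r v)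
    (h01 : 0 < cornerVec r v 0 1 0) (i j : Fin 4) : HypSpace :=
  if hij : i ≠ j then
    ⟨cornerVec r v i j, mink_cornerVec_self hr hv hij,
      time_pos_of_mink_neg (mink_cornerVec_self hr hv hij)
        (mink_cornerVec_self hr hv (by decide)) h01 (mink_cornerVec_neg hr hv hij (by decide))⟩
  else ⟨cornerVec r v 0 1, mink_cornerVec_self hr hv (by decide), h01⟩

lemma cornerPoint_val (hr : ∀ i, 0 < r i) (hv : IsGram r v) (h01 : 0 < cornerVec r v 0 1 0)
    {i j : Fin 4} (hij : i ≠ j) : (cornerPoint hr hv h01 i j).1 = cornerVec r v i j :=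
  congrArg Subtype.val (dif_pos hij)

/-- The hyper-ideal tetrahedron with given unit normals of the vertex triangles. -/
noncomputable def tetrahedronOfGram (hr : ∀ i, 0 < r i) (hv : IsGram r v)
    (h01 : 0 < cornerVec r v 0 1 0) (f : Fin 4 → Fin 4 → ℝ)
    (hf0 : ∀ h i, h ≠ i → mink (f h) (v i) = 0) (hf1 : ∀ h, mink (f h) (v h) < 0)
    (hf2 : ∀ h, 0 < mink (f h) (f h)) : HyperIdealTetrahedron where
  corner := cornerPoint hr hv h01
  truncNormal := v
  faceNormal := f
  truncNormal_spacelike i := by rw [hv, if_pos rfl]; exact one_pos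
  faceNormal_spacelike := hf2
  trunc_corner_eq i j hij := by
    rw [cornerPoint_val hr hv h01 hij]; exact mink_normal_cornerVec_eq hv hij
  trunc_corner_neg i j k hjk hji := by
    rw [cornerPoint_val hr hv h01 hjk]; exact mink_normal_cornerVec_neg hr hv hjk hji
  face_corner_eq h i j hij hi hj := by
    rw [cornerPoint_val hr hv h01 hij]; exact mink_dual_cornerVec_eq (hf0 h i hi) (hf0 h j hj)
  face_corner_neg h i j hij hh := by
    rw [cornerPoint_val hr hv h01 hij]; exact mink_dual_cornerVec_neg hr hf0 hf1 hij hh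
  orthogonal i h hih := by rw [mink_comm]; exact hf0 h i hih.symm

lemma exists_hasEdgeLengths_of_gram (hr : ∀ i, 0 < r i) (hv : IsGram r v)
    (h01 : 0 < cornerVec r v 0 1 0) (f : Fin 4 → Fin 4 → ℝ)
    (hf0 : ∀ h i, h ≠ i → mink (f h) (v i) = 0) (hf1 : ∀ h, mink (f h) (v h) < 0)
    (hf2 : ∀ h, 0 < mink (f h) (f h)) :
    ∃ P : HyperIdealTetrahedron, P.HasEdgeLengths (fun i j => r i + r j) := by
  refine ⟨tetrahedronOfGram hr hv h01 f hf0 hf1 hf2, fun i j hij => ?_⟩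
  simp only [HyperIdealTetrahedron.edgeLength, tetrahedronOfGram, hdist]
  rw [cornerPoint_val hr hv h01 hij, cornerPoint_val hr hv h01 hij.symm,
    mink_cornerVec_swap hr hv hij, neg_neg]
  exact Real.arcosh_cosh (add_pos (hr i) (hr j)).le

end Construction

lemma exists_hasEdgeLengths {r : Fin 4 → ℝ} (hr : ∀ i, 0 < r i)
    (hQ : 0 < Q₂ (fun i => Real.tanh (r i))) :
    ∃ P : HyperIdealTetrahedron, P.HasEdgeLengths (fun i j => r i + r j) := by
  obtain ⟨w, f, hw, hf0, hf1, hf2⟩ := exists_gram_and_dual (fun i => (tanh_mem_Ioo (hr i)).1) hQ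
  -- cosh(r_i + r_j) = cosh r_i cosh r_j (1 + t_i t_j) and 1 = cosh² r_i (1 - t_i²). The Gram matrix
  -- cannot tell v from -v; the sign ε is chosen below to put the corners in the upper sheet.
  have hgram : ∀ ε : ℝ, ε ^ 2 = 1 → IsGram r (fun i => (ε * Real.cosh (r i)) • w i) := by
    intro ε hε i j
    have hi := (Real.cosh_pos (r i)).ne'
    have hj := (Real.cosh_pos (r j)).ne'
    simp only [mink_smul_left, mink_smul_right, hw, Real.tanh_eq_sinh_div_cosh]
    by_cases hij : i = j
    · subst hij
      rw [if_pos rfl, if_pos rfl]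
      have := Real.cosh_sq (r i)
      field_simp
      rw [hε]
      linarith
    · rw [if_neg hij, if_neg hij, Real.cosh_add]
      field_simp
      rw [hε]
      ring
  have hneg : cornerVec r (fun i => ((-1 : ℝ) * Real.cosh (r i)) • w i) 0 1 0 =
      -cornerVec r (fun i => ((1 : ℝ) * Real.cosh (r i)) • w i) 0 1 0 := by
    simp only [cornerVec, Pi.smul_apply, Pi.add_apply, smul_eq_mul]
    ring
  have hself := mink_cornerVec_self hr (hgram 1 (by norm_num)) (i := 0) (j := 1) (by decide)
  obtain ⟨ε, hε, hpos⟩ : ∃ ε : ℝ, ε ^ 2 = 1 ∧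
      0 < cornerVec r (fun i => (ε * Real.cosh (r i)) • w i) 0 1 0 := by
    have h1 := one_le_sq_time hself
    rcases lt_or_ge 0 (cornerVec r (fun i => ((1 : ℝ) * Real.cosh (r i)) • w i) 0 1 0) with h | h
    · exact ⟨1, by norm_num, h⟩
    · refine ⟨-1, by norm_num, ?_⟩
      rw [hneg]
      nlinarith
  refine exists_hasEdgeLengths_of_gram hr (hgram ε hε) hpos (fun h => ε • f h) ?_ ?_ ?_
  · intro h i hi
    simp [hf0 h i hi]
  · intro h
    rw [mink_smul_left, mink_smul_right]
    have := mul_neg_of_pos_of_neg (Real.cosh_pos (r h)) (hf1 h)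
    calc _ = ε ^ 2 * (Real.cosh (r h) * mink (f h) (w h)) := by ring
      _ < 0 := by rw [hε, one_mul]; exact this
  · intro h
    rw [mink_smul_left, mink_smul_right, ← mul_assoc, ← sq, hε, one_mul]
    exact hf2 h

/-! ### The admissible spaces -/

lemma determinesTetrahedron {r : Fin 4 → ℝ} (hr : ∀ i, 0 < r i) :
    DeterminesTetrahedron (fun i j => r i + r j) := by
  obtain ⟨P, hP⟩ := exists_hasEdgeLengths hr (Q₂_pos fun i => tanh_mem_Ioo (hr i))
  exact ⟨P, hP, fun P' hP' => HyperIdealTetrahedron.congruent_of_edgeLength_eq fun i j hij =>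
    (hP i j hij).trans (hP' i j hij).symm⟩

lemma admissibleSpace_eq : admissibleSpace = {r : Fin 4 → ℝ | ∀ i, 0 < r i} :=
  Set.ext fun _ => ⟨fun h => h.1, fun h => ⟨h, determinesTetrahedron h⟩⟩

/-- Every boundary component is a vertex of some tetrahedron, so the conditions on single tetrahedra
bound every coordinate of r. -/
lemma IdealTriangulation.admissibleSpace_eq {M : Type*} [TopologicalSpace M]
    [ChartedSpace (EuclideanHalfSpace 3) M] (T : IdealTriangulation M) :
    T.admissibleSpace = {r : BoundaryComponent M → ℝ | ∀ v, 0 < r v} := by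
  ext r
  simp only [IdealTriangulation.admissibleSpace, HyperIdeal.admissibleSpace_eq, Set.mem_iInter,
    Set.mem_ofPred_eq]
  refine ⟨fun h v => ?_, fun h σ a => h _⟩
  obtain ⟨σ, a, rfl⟩ := T.vertex_surjective v
  exact h σ a

end HyperIdeal

theorem theorem2p2 :
    -- The admissible space of a single tetrahedron.
    HyperIdeal.admissibleSpace = {r : Fin 4 → ℝ | ∀ i, 0 < r i} ∧
    -- The admissible space of a triangulated compact 3-manifold with boundary.
    (∀ (M : Type*) [TopologicalSpace M] [T2Space M] [CompactSpace M]
      [ChartedSpace (EuclideanHalfSpace 3) M] (T : HyperIdeal.IdealTriangulation M),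
      T.admissibleSpace = {r : HyperIdeal.BoundaryComponent M → ℝ | ∀ v, 0 < r v}) ∧
    -- Non-degeneracy is the positivity of `Q₂`, and the triangle inequalities in the vertex
    -- triangles are governed by `Q₂`.
    (∀ r : Fin 4 → ℝ, (∀ i, 0 < r i) →
      (HyperIdeal.DeterminesTetrahedron (fun i j => r i + r j) ↔
        0 < HyperIdeal.Q₂ (fun i => Real.tanh (r i))) ∧
      ∀ P : HyperIdeal.HyperIdealTetrahedron, P.HasEdgeLengths (fun i j => r i + r j) →
        ∀ i j k h : Fin 4, i ≠ j → i ≠ k → i ≠ h → j ≠ k → j ≠ h → k ≠ h →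
          ∀ x y z : ℝ, x = P.vertexEdgeLength i j k → y = P.vertexEdgeLength i j h →
            z = P.vertexEdgeLength i k h →
            4 * Real.sinh ((x + y + z) / 2) * Real.sinh ((x + y - z) / 2) *
                Real.sinh ((x - y + z) / 2) * Real.sinh ((-x + y + z) / 2) =
              4 * (Real.cosh (r i) * Real.cosh (r j) * Real.cosh (r k) * Real.cosh (r h)) ^ 2 /
                (Real.sinh (r i + r j) * Real.sinh (r i + r k) * Real.sinh (r i + r h)) ^ 2 *
                HyperIdeal.Q₂ (fun a => Real.tanh (r a))) ∧
    (∀ t : Fin 4 → ℝ, (∀ i, t i ∈ Set.Ioo (0 : ℝ) 1) → 0 < HyperIdeal.Q₂ t) := by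
  -- The equivalence holds because both of its sides are true for every positive r.
  exact ⟨HyperIdeal.admissibleSpace_eq, fun M _ _ _ _ T => T.admissibleSpace_eq,
    fun r hr => ⟨⟨fun _ => HyperIdeal.Q₂_pos fun i => HyperIdeal.tanh_mem_Ioo (hr i),
      fun _ => HyperIdeal.determinesTetrahedron hr⟩,
      fun P hP i j k h hij hik hih hjk hjh hkh x y z hx hy hz =>
        P.sinh_identity hr hP hij hik hih hjk hjh hkh hx hy hz⟩,
    fun t ht => HyperIdeal.Q₂_pos ht⟩
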